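/- Let $T=(V,E)$ be a finite tree with $n=|V|$ nodes. Each node $i$ holds a block $X_i^B\in\{0,1\}^B$ of $B$ Boolean measurements. For integers $0\le a\le b\le n/2$ let $\Pi_{[a,b]}(X_1,\dots,X_n)=1$ if $a\le X_1+\dots+X_n\le b$, and $0$ otherwise. A strategy is a deterministic interactive protocol with finitely many rounds, in each of which every edge carries at most one bit: whether an endpoint of an edge transmits on it, and which one, is determined by the previous transmissions on that edge; the bit that node $i$ transmits may depend on $X_i^B$ and on all previous transmissions on the edges at $i$. Let $\mathcal S_B$ be the set of strategies that achieve zero-error block computation of $\Pi_{[a,b]}$, i.e. after which, for every input, every node $i$ can determine from $X_i^B$ and the transmissions on its edges the values of $\Pi_{[a,b]}$ on all $B$ instances of the block. For $S_B\in\mathcal S_B$ and an edge $e$, let $C_e(\Pi_{[a,b]},S_B,B)$ be the total number of bits exchanged on $e$, in both directions together, in the worst case over all inputs. For an edge $e$, whose removal splits $V$ into two components, let $A_e$ be a component with $|A_e|\le|V\setminus A_e|$. Then for every strategy $S_B\in\mathcal S_B$ and every edge $e$, $$C_e(\Pi_{[a,b]},S_B,B)\ \ge\ B\log_2\bigl(\min\{2b-a+3,\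 |A_e|+1\}\bigr).$$ Further, there exists a strategy $S_B^*\in\mathcal S_B$ such that for every edge $e$, $$C_e(\Pi_{[a,b]},S_B^*,B)\ \le\ \bigl\lceil B\log_2\bigl(\min\{2(b+1)+1,\ 2|A_e|+2\}\bigr)\bigr\rceil .$$ -/

import Mathlib

namespace TreeNetwork

/-- The sum-interval function `Π_[a,b]`: it is `1` if and only if the number of ones among the
Boolean variables lies between `a` and `b`. -/
def sumInterval {V : Type*} [Fintype V] (a b : ℕ) (x : V → Bool) : Bool :=
  decide (a ≤ ∑ v, (x v).toNat ∧ ∑ v, (x v).toNat ≤ b)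

/-- What has happened so far on one link, one entry per elapsed round (oldest first):
`none` if neither endpoint transmitted in that round, `some c` if the bit `c` was transmitted. -/
abbrev LinkHistory : Type := List (Option Bool)

/-- A deterministic interactive strategy on the network `G` for blocks of `B` measurements. In each
round, every link carries at most one bit.
* `rounds` is the number of rounds after which the strategy stops.
* `speaker e h` says which of the two endpoints of the link `e` transmits in the next round, or that
  neither does; it is determined by the previous transmissions on `e` (those that both
  endpoints have heard).
* `bit i x H e` is the bit that node `i`, if it is to transmit on its link `e`, puts on it; it may
  depend on the measurement block `x` of node `i` and on the histories `H` of all links at `i`.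
* `output i x H` is the block of function values that node `i` declares at the end. -/
structure Strategy {V : Type*} (G : SimpleGraph V) (B : ℕ) where
  rounds : ℕ
  speaker : (e : G.edgeSet) → LinkHistory → Option {v : V // v ∈ (e : Sym2 V)}
  bit : (i : V) → (Fin B → Bool) → (G.incidenceSet i → LinkHistory) → G.incidenceSet i → Bool
  output : (i : V) → (Fin B → Bool) → (G.incidenceSet i → LinkHistory) → (Fin B → Bool)

namespace Strategy

variable {V : Type*} {G : SimpleGraph V} {B : ℕ}

/-- The part of the histories of all links that node `i` hears: the links incident to `i`. -/
def localView (H : G.edgeSet → LinkHistory) (i : V) : G.incidenceSet i → LinkHistory :=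
  fun e => H ⟨e.1, e.2.1⟩

/-- What happens on link `e` in the next round, if the histories so far are `H` and
the measurement blocks are `X`. -/
def transmission (S : Strategy G B) (X : V → Fin B → Bool) (H : G.edgeSet → LinkHistory)
    (e : G.edgeSet) : Option Bool :=
  (S.speaker e (H e)).map fun i => S.bit i.1 (X i.1) (localView H i.1) ⟨e.1, e.2, i.2⟩

/-- The histories of all links after `t` rounds, on the measurement blocks `X`. -/
def run (S : Strategy G B) (X : V → Fin B → Bool) : ℕ → G.edgeSet → LinkHistory
  | 0 => fun _ => []
  | t + 1 => fun e => S.run X t e ++ [S.transmission X (S.run X t) e]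

/-- Correct (zero-error) block computation of `f`: on every input, every node outputs
the block of the `B` values of `f`. -/
def Computes (S : Strategy G B) (f : (V → Bool) → Bool) : Prop :=
  ∀ (X : V → Fin B → Bool) (i : V),
    S.output i (X i) (localView (S.run X S.rounds) i) = fun k => f fun v => X v k

/-- The number of bits exchanged on link `e` (in both directions together) on input `X`. -/
def bitsOn (S : Strategy G B) (X : V → Fin B → Bool) (e : G.edgeSet) : ℕ :=
  (S.run X S.rounds e).countP Option.isSome

/-- The worst-case total number of bits exchanged on link `e`. -/
def worstCaseBits [Fintype V] [DecidableEq V] (S : Strategy G B) (e : G.edgeSet) : ℕ :=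
  Finset.univ.sup fun X : V → Fin B → Bool => S.bitsOn X e

end Strategy

/-- The component that contains `i` once the edge `{i, j}` has been removed from `G`. -/
def side {V : Type*} (G : SimpleGraph V) (i j : V) : Set V :=
  {v | (G.deleteEdges {s(i, j)}).Reachable i v}

end TreeNetwork

/-! Lower bound: deleting `{i, j}` leaves a two-party problem between the two sides. If two inputs
give the same history on that link, an input mixed from them looks like the first to one side and
like the second to the other (`run_mix`), so both inputs and the mixture share one block of values.
Inputs for which this fails pairwise have distinct histories, and a history is determined by its
bits, so K^B such inputs force K^B ≤ 2^C. Only the numbers of ones (x, y) on the two sides matter.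
With m nodes on the smaller side, the pairs of sum b give K = m + 1 if m ≤ b. If m > b, the b + 1
pairs of sum b together with b - a + 2 pairs of sum b + 1 give K = 2b - a + 3.

Upper bound: root the tree at a centroid, so that the subtree below each link is no larger than the
rest. Every node sends its parent the block u of its subtree counts, capped at b + 1; afterwards the
parent returns the value only for the r(u) instances with count at most b, since a capped count
already means value 0. A link thus carries |code(u)| + r(u) bits. Taking |code(u)| = L - r(u) makes
this L for every u, and by Kraft (`exists_prefix_code`) such a prefix code exists when ∑ 2^r(u) ≤
2^L. The sum is a B-th power: each coordinate contributes 2 per value up to b and 1 for the value b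
+ 1 (`sum_two_pow_card_filter`). -/

namespace TreeNetwork

/-! ### Cut and paste over one link -/

section Cut

variable {V : Type*} {G : SimpleGraph V} {B : ℕ}

lemma mem_side_self (i j : V) : i ∈ side G i j := SimpleGraph.Reachable.refl _

lemma mem_side_iff_of_adj {i j u v : V} (h : G.Adj u v) (hne : s(u, v) ≠ s(i, j)) :
    u ∈ side G i j ↔ v ∈ side G i j := by
  have hadj : (G.deleteEdges {s(i, j)}).Adj u v := by
    simp only [SimpleGraph.deleteEdges_adj, Set.mem_singleton_iff]
    exact ⟨h, hne⟩
  exact ⟨fun hu => SimpleGraph.Reachable.trans hu hadj.reachable,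
    fun hv => SimpleGraph.Reachable.trans hv hadj.symm.reachable⟩

lemma not_mem_side_of_isTree (hG : G.IsTree) {i j : V} (hij : G.Adj i j) : j ∉ side G i j := by
  have h := SimpleGraph.isAcyclic_iff_forall_adj_isBridge.1 hG.isAcyclic hij
  rw [SimpleGraph.isBridge_iff] at h
  exact h

namespace Strategy

/-- The input that agrees with `X` on `A` and with `Y` off `A`. -/
noncomputable def mix {α : Type*} (A : Set V) (X Y : V → α) : V → α :=
  open Classical in fun v => if v ∈ A then X v else Y v

lemma mix_of_mem {α : Type*} {A : Set V} {X Y : V → α} {v : V} (h : v ∈ A) :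
    mix A X Y v = X v := by simp [mix, h]

lemma mix_of_not_mem {α : Type*} {A : Set V} {X Y : V → α} {v : V} (h : v ∉ A) :
    mix A X Y v = Y v := by simp [mix, h]

lemma length_run (S : Strategy G B) (X : V → Fin B → Bool) (t : ℕ) (e : G.edgeSet) :
    (S.run X t e).length = t := by
  induction t with
  | zero => rfl
  | succ t ih => simp [run, ih]

lemma run_eq_of_le (S : Strategy G B) {X Y : V → Fin B → Bool} {e : G.edgeSet} {t : ℕ}
    (h : S.run X t e = S.run Y t e) {s : ℕ} (hs : s ≤ t) : S.run X s e = S.run Y s e := by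
  induction t with
  | zero => obtain rfl : s = 0 := by omega
            exact h
  | succ t ih =>
    rcases Nat.lt_or_ge s (t + 1) with h1 | h1
    · refine ih ?_ (by omega)
      exact (List.append_inj h (by simp [length_run])).1
    · obtain rfl : s = t + 1 := by omega
      exact h

lemma transmission_congr (S : Strategy G B) {X Y : V → Fin B → Bool}
    {H K : G.edgeSet → LinkHistory} {e : G.edgeSet} (he : H e = K e)
    (h : ∀ v, S.speaker e (H e) = some v →
      X v.1 = Y v.1 ∧ localView H v.1 = localView K v.1) :
    S.transmission X H e = S.transmission Y K e := by
  unfold transmission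
  rw [← he]
  cases hs : S.speaker e (H e) with
  | none => rfl
  | some v =>
    obtain ⟨h1, h2⟩ := h v hs
    simp [h1, h2]

/-- Cut and paste: if two inputs yield the same history on the only edge `{i, j}` that crosses
a cut, then the mixed input runs like the one on the one side and like the other on the other. -/
lemma run_mix (S : Strategy G B) {X Y : V → Fin B → Bool} {i j : V} (hij : G.Adj i j) {t : ℕ}
    (h : S.run X t ⟨s(i, j), hij⟩ = S.run Y t ⟨s(i, j), hij⟩) (e : G.edgeSet) :
    ((∃ v ∈ (e : Sym2 V), v ∈ side G i j) →
      S.run (mix (side G i j) X Y) t e = S.run X t e) ∧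
    ((∃ v ∈ (e : Sym2 V), v ∉ side G i j) →
      S.run (mix (side G i j) X Y) t e = S.run Y t e) := by
  induction t generalizing e with
  | zero => exact ⟨fun _ => rfl, fun _ => rfl⟩
  | succ t ih =>
    have h0 := S.run_eq_of_le h (Nat.le_succ t)
    have htr : S.transmission X (S.run X t) ⟨s(i, j), hij⟩
        = S.transmission Y (S.run Y t) ⟨s(i, j), hij⟩ := by
      have := (List.append_inj h (by simp [length_run])).2
      simpa using this
    have ih := fun e => ih h0 e
    set A := side G i j with hA
    have inA : ∀ e : G.edgeSet, ∀ v ∈ (e : Sym2 V), v ∈ A →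
        S.run (mix A X Y) t e = S.run X t e := fun e v hv hvA => (ih e).1 ⟨v, hv, hvA⟩
    have outA : ∀ e : G.edgeSet, ∀ v ∈ (e : Sym2 V), v ∉ A →
        S.run (mix A X Y) t e = S.run Y t e := fun e v hv hvA => (ih e).2 ⟨v, hv, hvA⟩
    have cross : ∀ e : G.edgeSet, ∀ v ∈ (e : Sym2 V), v ∈ A → ∀ w ∈ (e : Sym2 V), w ∉ A →
        e = ⟨s(i, j), hij⟩ := by
      intro e v hv hvA w hw hwA
      by_contra hne
      have hvw : v ≠ w := by rintro rfl; exact hwA hvA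
      have hes : (e : Sym2 V) = s(v, w) := (Sym2.mem_and_mem_iff hvw).1 ⟨hv, hw⟩
      have hadj : G.Adj v w := by
        have := e.2
        rwa [hes] at this
      refine hwA ((mem_side_iff_of_adj hadj ?_).1 hvA)
      rw [← hes]
      exact fun h => hne (Subtype.ext h)
    -- The speaker sees only links that touch its own side, which settles that side. Only `{i, j}`
    -- touches both sides, and there `htr` carries the bit over to the other input.
    have step : ∀ e : G.edgeSet,
        ((∃ v ∈ (e : Sym2 V), v ∈ A) →
          S.transmission (mix A X Y) (S.run (mix A X Y) t) e = S.transmission X (S.run X t) e) ∧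
        ((∃ v ∈ (e : Sym2 V), v ∉ A) →
          S.transmission (mix A X Y) (S.run (mix A X Y) t) e
            = S.transmission Y (S.run Y t) e) := by
      intro e
      have spA : ∀ w, S.speaker e (S.run (mix A X Y) t e) = some w → w.1 ∈ A →
          S.transmission (mix A X Y) (S.run (mix A X Y) t) e
            = S.transmission X (S.run X t) e := by
        intro w hw hwA
        refine S.transmission_congr (inA e _ w.2 hwA) fun v hv => ?_
        obtain rfl : w = v := Option.some_injective _ (hw.symm.trans hv)
        exact ⟨mix_of_mem hwA, funext fun e' => inA _ _ e'.2.2 hwA⟩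
      have spB : ∀ w, S.speaker e (S.run (mix A X Y) t e) = some w → w.1 ∉ A →
          S.transmission (mix A X Y) (S.run (mix A X Y) t) e
            = S.transmission Y (S.run Y t) e := by
        intro w hw hwA
        refine S.transmission_congr (outA e _ w.2 hwA) fun v hv => ?_
        obtain rfl : w = v := Option.some_injective _ (hw.symm.trans hv)
        exact ⟨mix_of_not_mem hwA, funext fun e' => outA _ _ e'.2.2 hwA⟩
      cases hs : S.speaker e (S.run (mix A X Y) t e) with
      | none =>
        refine ⟨?_, ?_⟩ <;> rintro ⟨v, hv, hvA⟩
        · exact S.transmission_congr (inA e v hv hvA) (by simp [hs])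
        · exact S.transmission_congr (outA e v hv hvA) (by simp [hs])
      | some w =>
        by_cases hwA : w.1 ∈ A
        · refine ⟨fun _ => spA w hs hwA, ?_⟩
          rintro ⟨v, hv, hvA⟩
          obtain rfl := cross e _ w.2 hwA v hv hvA
          rw [spA w hs hwA, htr]
        · refine ⟨?_, fun _ => spB w hs hwA⟩
          rintro ⟨v, hv, hvA⟩
          obtain rfl := cross e v hv hvA _ w.2 hwA
          rw [spB w hs hwA, htr]
    constructor
    · rintro ⟨v, hv, hvA⟩
      simp only [run]
      rw [inA e v hv hvA, (step e).1 ⟨v, hv, hvA⟩]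
    · rintro ⟨v, hv, hvA⟩
      simp only [run]
      rw [outA e v hv hvA, (step e).2 ⟨v, hv, hvA⟩]

/-- Inputs that yield the same history on the link `{i, j}` have the same block of values of the
computed function as the input that is mixed from them. -/
lemma Computes.eq_of_run_eq {S : Strategy G B} {f : (V → Bool) → Bool} (hS : S.Computes f)
    {X Y : V → Fin B → Bool} {i j : V} (hij : G.Adj i j) (hj : j ∉ side G i j)
    (h : S.run X S.rounds ⟨s(i, j), hij⟩ = S.run Y S.rounds ⟨s(i, j), hij⟩) (k : Fin B) :
    f (fun v => mix (side G i j) X Y v k) = f (fun v => X v k) ∧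
    f (fun v => mix (side G i j) X Y v k) = f (fun v => Y v k) := by
  have hi := mem_side_self (G := G) i j
  constructor
  · have h1 := hS (mix (side G i j) X Y) i
    have h2 : localView (S.run (mix (side G i j) X Y) S.rounds) i
        = localView (S.run X S.rounds) i :=
      funext fun e => (S.run_mix hij h _).1 ⟨i, e.2.2, hi⟩
    rw [h2, mix_of_mem hi, hS X i] at h1
    exact (congrFun h1 k).symm
  · have h1 := hS (mix (side G i j) X Y) j
    have h2 : localView (S.run (mix (side G i j) X Y) S.rounds) j
        = localView (S.run Y S.rounds) j :=
      funext fun e => (S.run_mix hij h _).2 ⟨j, e.2.2, hj⟩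
    rw [h2, mix_of_not_mem hj, hS Y j] at h1
    exact (congrFun h1 k).symm

/-- The bits transmitted on a link determine its history. -/
lemma run_eq_of_bits (S : Strategy G B) {X Y : V → Fin B → Bool} {e : G.edgeSet}
    {C : ℕ} (hX : S.bitsOn X e ≤ C)
    (h : ∀ k < C, ((S.run X S.rounds e).reduceOption).getD k false
      = ((S.run Y S.rounds e).reduceOption).getD k false) :
    ∀ t ≤ S.rounds, S.run X t e = S.run Y t e := by
  have pre : ∀ (Z : V → Fin B → Bool) (d t : ℕ), S.run Z t e <+: S.run Z (t + d) e := by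
    intro Z d t
    induction d with
    | zero => exact List.prefix_rfl
    | succ d ih => exact ih.trans (List.prefix_append _ _)
  -- The bit of round `t` sits, among all bits of the link, at the index given by the number of bits
  -- sent earlier.
  have bit : ∀ (Z : V → Fin B → Bool) (t : ℕ) (c : Bool), t < S.rounds →
      S.transmission Z (S.run Z t) e = some c →
      ((S.run Z S.rounds e).reduceOption)[(S.run Z t e).reduceOption.length]? = some c := by
    intro Z t c ht hc
    obtain ⟨d, hd⟩ := Nat.exists_eq_add_of_le (Nat.succ_le_of_lt ht)
    obtain ⟨l, hl⟩ := pre Z d (t + 1)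
    rw [hd, ← hl]
    change (S.run Z t e ++ [S.transmission Z (S.run Z t) e] ++ l).reduceOption[_]? = some c
    rw [hc, List.reduceOption_append, List.reduceOption_append]
    simp [List.reduceOption]
  intro t
  induction t with
  | zero => intro _; rfl
  | succ t ih =>
    intro ht
    have ih := ih (by omega)
    have key : S.transmission X (S.run X t) e = S.transmission Y (S.run Y t) e := by
      -- Who speaks depends on the link's history alone, so by induction silence falls on both
      -- inputs or on neither.
      have hsp : S.speaker e (S.run X t e) = S.speaker e (S.run Y t e) := by rw [ih]
      cases hs : S.speaker e (S.run X t e) with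
      | none => rw [hs] at hsp; simp [transmission, hs, ← hsp]
      | some w =>
        rw [hs] at hsp
        obtain ⟨c, hc⟩ : ∃ c, S.transmission X (S.run X t) e = some c := by
          simp [transmission, hs]
        obtain ⟨c', hc'⟩ : ∃ c, S.transmission Y (S.run Y t) e = some c := by
          simp [transmission, ← hsp]
        have b1 := bit X t c (by omega) hc
        have b2 := bit Y t c' (by omega) hc'
        have hlt : (S.run X t e).reduceOption.length < C := by
          have := (List.getElem?_eq_some_iff.1 b1).1
          refine lt_of_lt_of_le this (le_trans (le_of_eq ?_) hX)
          rw [bitsOn, List.reduceOption_length_eq, List.countP_eq_length_filter]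
        have := h _ hlt
        rw [List.getD_eq_getElem?_getD, b1, List.getD_eq_getElem?_getD, ih, b2] at this
        simp only [Option.getD_some] at this
        rw [hc, hc', this]
    simp only [run, ih]
    rw [← key]

/-- If all inputs in a family have different histories on a link, then this link carries
at least the logarithm of the size of the family. -/
lemma card_le_two_pow (S : Strategy G B) {Q : Type*} [Fintype Q] (X : Q → V → Fin B → Bool)
    (e : G.edgeSet) (hX : ∀ q q', S.run (X q) S.rounds e = S.run (X q') S.rounds e → q = q')
    {C : ℕ} (hC : ∀ q, S.bitsOn (X q) e ≤ C) : Fintype.card Q ≤ 2 ^ C := by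
  -- The bits are padded with `false` to length `C`; the padding is harmless because the history
  -- itself tells when the bits end.
  have hinj : Function.Injective fun (q : Q) (k : Fin C) =>
      ((S.run (X q) S.rounds e).reduceOption).getD k false := by
    intro q q' h
    refine hX q q' (S.run_eq_of_bits (hC q) (fun k hk => ?_) _ le_rfl)
    exact congrFun h ⟨k, hk⟩
  simpa using Fintype.card_le_of_injective _ hinj

end Strategy
end Cut
-- Fooling sets and the lower bound
lemma bitsOn_le_worstCaseBits {V : Type*} [Fintype V] [DecidableEq V] {G : SimpleGraph V} {B : ℕ}
    (S : Strategy G B) (X : V → Fin B → Bool) (e : G.edgeSet) :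
    S.bitsOn X e ≤ S.worstCaseBits e :=
  Finset.le_sup (f := fun X => S.bitsOn X e) (Finset.mem_univ X)

/-- A family of inputs to a two-party problem that is to be solved over the cut `{i, j}`, given by
the numbers of ones on both sides, no two of which can share a transcript. -/
lemma card_pow_le_two_pow_worstCaseBits {V : Type*} [Fintype V] [DecidableEq V]
    {G : SimpleGraph V} {B a b : ℕ} (S : Strategy G B) (hS : S.Computes (sumInterval a b))
    {i j : V} (hij : G.Adj i j) (hj : j ∉ side G i j)
    {Q : Type*} [Fintype Q] (x y : Q → ℕ) (hx : ∀ q, x q ≤ (side G i j).ncard)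
    (hy : ∀ q, y q ≤ (side G i j)ᶜ.ncard)
    (hfool : ∀ q q', ((a ≤ x q + y q' ∧ x q + y q' ≤ b) ↔ (a ≤ x q + y q ∧ x q + y q ≤ b)) →
      ((a ≤ x q + y q' ∧ x q + y q' ≤ b) ↔ (a ≤ x q' + y q' ∧ x q' + y q' ≤ b)) →
      ((a ≤ x q' + y q ∧ x q' + y q ≤ b) ↔ (a ≤ x q' + y q' ∧ x q' + y q' ≤ b)) → q = q') :
    Fintype.card Q ^ B ≤ 2 ^ S.worstCaseBits ⟨s(i, j), hij⟩ := by
  classical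
  set A := side G i j with hA
  have hs : ∀ q, ∃ s : Finset V, (s : Set V) ⊆ A ∧ s.card = x q := by
    intro q
    have := hx q
    rw [Set.ncard_eq_toFinset_card'] at this
    obtain ⟨s, hs, hc⟩ := Finset.exists_subset_card_eq this
    exact ⟨s, fun v hv => by simpa using hs hv, hc⟩
  have ht : ∀ q, ∃ t : Finset V, (t : Set V) ⊆ Aᶜ ∧ t.card = y q := by
    intro q
    have := hy q
    rw [Set.ncard_eq_toFinset_card'] at this
    obtain ⟨s, hs, hc⟩ := Finset.exists_subset_card_eq this
    exact ⟨s, fun v hv => by simpa using hs hv, hc⟩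
  choose s hsA hsx using hs
  choose t htA hty using ht
  let X : (Fin B → Q) → V → Fin B → Bool := fun q v k => decide (v ∈ s (q k) ∪ t (q k))
  have hmix : ∀ q q' k v, Strategy.mix A (X q) (X q') v k
      = decide (v ∈ s (q k) ∪ t (q' k)) := by
    intro q q' k v
    by_cases hv : v ∈ A
    · have h1 : ∀ q, v ∉ t q := fun q h => htA q h hv
      simp [Strategy.mix_of_mem hv, X, h1]
    · have h1 : ∀ q, v ∉ s q := fun q h => hv (hsA q h)
      simp [Strategy.mix_of_not_mem hv, X, h1]
  have hval : ∀ q q', sumInterval a b (fun v => decide (v ∈ s q ∪ t q'))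
      = decide (a ≤ x q + y q' ∧ x q + y q' ≤ b) := by
    intro q q'
    have hd : Disjoint (s q) (t q') :=
      Finset.disjoint_left.2 fun v h1 h2 => htA q' h2 (hsA q h1)
    have : ∑ v, (decide (v ∈ s q ∪ t q')).toNat = x q + y q' := by
      rw [← hsx, ← hty, ← Finset.card_union_of_disjoint hd]
      simp only [Bool.toNat, Bool.cond_decide, Finset.sum_ite_mem, Finset.univ_inter,
        Finset.sum_const, smul_eq_mul, mul_one]
    simp only [sumInterval, this]
  have := S.card_le_two_pow X ⟨s(i, j), hij⟩ (C := S.worstCaseBits ⟨s(i, j), hij⟩) (fun q q' h => by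
    funext k
    have h1 := hS.eq_of_run_eq hij hj h k
    have h2 := hS.eq_of_run_eq hij hj h.symm k
    rw [← hA] at h1 h2
    simp only [hmix] at h1 h2
    simp only [X, hval, decide_eq_decide] at h1 h2
    exact hfool _ _ h1.1 h1.2 h2.1) (fun q => bitsOn_le_worstCaseBits S _ _)
  simpa using this

/-- The lower bound. -/
lemma mul_logb_le_worstCaseBits {V : Type*} [Fintype V] [DecidableEq V]
    {G : SimpleGraph V} {B a b : ℕ} (hab : a ≤ b) (S : Strategy G B)
    (hS : S.Computes (sumInterval a b))
    {i j : V} (hij : G.Adj i j) (hj : j ∉ side G i j)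
    (hle : (side G i j).ncard ≤ (side G i j)ᶜ.ncard) (hb : b ≤ (side G i j)ᶜ.ncard) :
    (B : ℝ) * Real.logb 2 (min (2 * (b : ℝ) - (a : ℝ) + 3) (((side G i j).ncard : ℝ) + 1))
      ≤ (S.worstCaseBits ⟨s(i, j), hij⟩ : ℝ) := by
  have habR : (a : ℝ) ≤ b := by exact_mod_cast hab
  have hbR : (0 : ℝ) ≤ b := b.cast_nonneg
  set m := (side G i j).ncard with hm
  have hmR : (0 : ℝ) ≤ m := m.cast_nonneg
  suffices h : ∃ K : ℕ, K ^ B ≤ 2 ^ S.worstCaseBits ⟨s(i, j), hij⟩ ∧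
      min (2 * (b : ℝ) - (a : ℝ) + 3) ((m : ℝ) + 1) ≤ K by
    obtain ⟨K, hK, hle⟩ := h
    have h0 : 0 < min (2 * (b : ℝ) - (a : ℝ) + 3) ((m : ℝ) + 1) :=
      lt_min (by linarith) (by linarith)
    have hK0 : (0 : ℝ) < K := h0.trans_le hle
    calc _ ≤ (B : ℝ) * Real.logb 2 K := by
          gcongr
          norm_num
      _ = Real.logb 2 ((K : ℝ) ^ B) := (Real.logb_pow _ _ _).symm
      _ ≤ Real.logb 2 (2 ^ S.worstCaseBits ⟨s(i, j), hij⟩) := by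
          refine Real.logb_le_logb_of_le (by norm_num) (by positivity) ?_
          exact_mod_cast hK
      _ = _ := by rw [Real.logb_pow]; simp
  rcases le_or_gt m b with h | h
  -- Pairs (q, b - q) have value 1; for q ≠ q' one of the two exchanges raises the sum above b.
  · refine ⟨m + 1, ?_, by push_cast; exact min_le_right _ _⟩
    have := card_pow_le_two_pow_worstCaseBits S hS hij hj (Q := Fin (m + 1)) (fun q => q)
      (fun q => b - q) (fun q => by have := q.2; omega) (fun q => by omega) (fun q q' h1 h2 h3 => by
        have := q.2; have := q'.2
        ext; omega)
    simpa using this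
  -- The added pairs (q, b + 1 - q), q ≤ b - a + 1, have value 0. Exchanging two of them in the
  -- right order lowers the sum by at most b - a + 1, into [a, b]. Pairs from different families
  -- differ in value.
  · refine ⟨(b + 1) + (b - a + 2), ?_, ?_⟩
    · have := card_pow_le_two_pow_worstCaseBits S hS hij hj (Q := Fin (b + 1) ⊕ Fin (b - a + 2))
        (Sum.elim (fun q => q) (fun q => q))
        (Sum.elim (fun q => b - q) (fun q => b + 1 - q))
        (by rintro (q | q) <;> have := q.2 <;> simp only [Sum.elim_inl, Sum.elim_inr] <;> omega)
        (by rintro (q | q) <;> have := q.2 <;> simp only [Sum.elim_inl, Sum.elim_inr] <;> omega)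
        (by
          rintro (q | q) (q' | q') <;> have := q.2 <;> have := q'.2 <;>
            simp only [Sum.elim_inl, Sum.elim_inr] <;> intro h1 h2 h3
          · congr 1; ext; omega
          · omega
          · omega
          · congr 1; ext; omega)
      simpa using this
    · refine (min_le_left _ _).trans ?_
      push_cast [hab]
      linarith

/-! ### Rooted trees -/

/-- A choice of a root of a tree, with the resulting parents and depths. -/
structure Rooting {V : Type*} (T : SimpleGraph V) where
  root : V
  parent : V → V
  depth : V → ℕ
  parent_root : parent root = root
  depth_root : depth root = 0
  depth_parent : ∀ v, v ≠ root → depth (parent v) + 1 = depth v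
  adj_iff : ∀ u v, T.Adj u v ↔ (u ≠ root ∧ parent u = v) ∨ (v ≠ root ∧ parent v = u)

namespace Rooting

variable {V : Type*} {T : SimpleGraph V} (R : Rooting T)

/-- The nodes of the subtree that hangs from `i`. -/
def below (i : V) : Set V := {v | ∃ n, R.parent^[n] v = i}

lemma mem_below_self (i : V) : i ∈ R.below i := ⟨0, rfl⟩

lemma mem_below_of_parent {v i : V} (h : R.parent v ∈ R.below i) : v ∈ R.below i := by
  obtain ⟨n, hn⟩ := h
  exact ⟨n + 1, hn⟩

lemma parent_mem_below {v i : V} (h : v ∈ R.below i) (hv : v ≠ i) : R.parent v ∈ R.below i := by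
  obtain ⟨n, hn⟩ := h
  cases n with
  | zero => exact absurd hn hv
  | succ n => exact ⟨n, hn⟩

lemma below_subset {i j : V} (h : i ∈ R.below j) : R.below i ⊆ R.below j := by
  rintro v ⟨n, rfl⟩
  obtain ⟨m, rfl⟩ := h
  exact ⟨m + n, Function.iterate_add_apply _ _ _ _⟩

lemma eq_root_of_depth {v : V} (h : R.depth v = 0) : v = R.root := by
  by_contra hv
  have := R.depth_parent v hv
  omega

lemma depth_pos {v : V} (hv : v ≠ R.root) : 0 < R.depth v := by
  have := R.depth_parent v hv
  omega

lemma depth_iterate (n : ℕ) (v : V) : R.depth (R.parent^[n] v) = R.depth v - n := by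
  induction n with
  | zero => rfl
  | succ n ih =>
    rw [Function.iterate_succ_apply']
    by_cases h : R.parent^[n] v = R.root
    · rw [h, R.depth_root] at ih
      rw [h, R.parent_root, R.depth_root]
      omega
    · have := R.depth_parent _ h
      omega

lemma depth_le_of_mem_below {v i : V} (h : v ∈ R.below i) : R.depth i ≤ R.depth v := by
  obtain ⟨n, rfl⟩ := h
  rw [R.depth_iterate]
  omega

lemma mem_below_root (v : V) : v ∈ R.below R.root :=
  ⟨R.depth v, R.eq_root_of_depth (by rw [R.depth_iterate]; omega)⟩

lemma adj_parent {v : V} (hv : v ≠ R.root) : T.Adj v (R.parent v) :=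
  (R.adj_iff _ _).2 (Or.inl ⟨hv, rfl⟩)

lemma parent_ne {v : V} (hv : v ≠ R.root) : R.parent v ≠ v := (R.adj_parent hv).ne'

lemma eq_of_mem_below {v c c' : V} (h : v ∈ R.below c) (h' : v ∈ R.below c') (hc : c ≠ R.root)
    (hd : R.depth c = R.depth c') : c = c' := by
  obtain ⟨n, rfl⟩ := h
  obtain ⟨n', rfl⟩ := h'
  -- Iterates stay at the root once they reach it; positive depth excludes this, so the depth fixes
  -- the number of iterations.
  have h1 := R.depth_pos hc
  rw [R.depth_iterate] at h1 hd
  rw [R.depth_iterate] at hd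
  rw [show n = n' by omega]

lemma exists_child_of_mem_below {v i : V} (h : v ∈ R.below i) (hv : v ≠ i) :
    ∃ c, c ≠ R.root ∧ R.parent c = i ∧ v ∈ R.below c := by
  obtain ⟨n, hn⟩ := h
  induction n with
  | zero => exact absurd hn hv
  | succ n ih =>
    by_cases h : R.parent^[n] v = i
    · exact ih h
    · rw [Function.iterate_succ_apply'] at hn
      refine ⟨R.parent^[n] v, ?_, hn, n, rfl⟩
      intro hr
      rw [hr, R.parent_root] at hn
      exact h (hr.trans hn)

lemma edge_injective {v w : V} (hv : v ≠ R.root) (hw : w ≠ R.root)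
    (h : s(v, R.parent v) = s(w, R.parent w)) : v = w := by
  rcases Sym2.eq_iff.1 h with ⟨h1, -⟩ | ⟨h1, h2⟩
  · exact h1
  · have a := R.depth_parent v hv
    have b := R.depth_parent w hw
    rw [h2] at a
    rw [← h1] at b
    omega

/-- The only edge that leaves the subtree at `c` is the deleted one. -/
lemma side_parent {c : V} (hc : c ≠ R.root) : side T c (R.parent c) = R.below c := by
  apply Set.Subset.antisymm
  · rintro v ⟨w⟩
    have : ∀ {x y : V}, (T.deleteEdges {s(c, R.parent c)}).Walk x y → x ∈ R.below c →
        y ∈ R.below c := by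
      intro x y w
      induction w with
      | nil => exact id
      | @cons x y z h p ih =>
        intro hx
        refine ih ?_
        rw [SimpleGraph.deleteEdges_adj, Set.mem_singleton_iff] at h
        rcases (R.adj_iff _ _).1 h.1 with ⟨hr, rfl⟩ | ⟨hr, rfl⟩
        · refine R.parent_mem_below hx ?_
          rintro rfl
          exact h.2 rfl
        · exact R.mem_below_of_parent hx
    exact this w (R.mem_below_self c)
  · rintro v ⟨n, hn⟩
    induction n generalizing v with
    | zero =>
      obtain rfl : v = c := hn
      exact mem_side_self _ _
    | succ n ih =>
      by_cases hvc : v = c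
      · subst hvc; exact mem_side_self _ _
      by_cases hr : v = R.root
      · rw [hr] at hn
        rw [Function.iterate_fixed R.parent_root] at hn
        exact absurd hn.symm hc
      · refine (mem_side_iff_of_adj (R.adj_parent hr) ?_).2 (ih hn)
        exact fun h => hvc (R.edge_injective hr hc h)

/-- The path to the root from a node outside the subtree of `c` avoids the deleted edge, so all such
nodes, `parent c` among them, lie in the root's component. -/
lemma compl_below_subset_side {c : V} (hc : c ≠ R.root) :
    (R.below c)ᶜ ⊆ side T (R.parent c) c := by
  have key : ∀ v, v ∉ R.below c → (v ∈ side T (R.parent c) c ↔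
      R.root ∈ side T (R.parent c) c) := by
    intro v hv
    obtain ⟨n, hn⟩ := R.mem_below_root v
    induction n generalizing v with
    | zero => rw [show v = R.root from hn]
    | succ n ih =>
      by_cases hr : v = R.root
      · rw [hr]
      · have h1 : R.parent v ∉ R.below c := fun h => hv (R.mem_below_of_parent h)
        rw [← ih _ h1 hn]
        refine mem_side_iff_of_adj (R.adj_parent hr) ?_
        rw [Sym2.eq_swap (a := R.parent c)]
        intro h
        rw [R.edge_injective hr hc h] at hv
        exact hv (R.mem_below_self c)
  have hp : R.parent c ∉ R.below c := by
    intro h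
    have h1 := R.depth_le_of_mem_below h
    have h2 := R.depth_parent c hc
    omega
  intro v hv
  exact (key v hv).2 ((key _ hp).1 (mem_side_self _ _))

/-- The total of `g` over the subtree at `i`. -/
noncomputable def belowSum [Fintype V] (g : V → ℕ) (i : V) : ℕ :=
  open Classical in ∑ v with v ∈ R.below i, g v

/-- The children of a node. -/
noncomputable def children [Fintype V] (i : V) : Finset V :=
  open Classical in Finset.univ.filter fun c => c ≠ R.root ∧ R.parent c = i

lemma mem_children [Fintype V] {i c : V} :
    c ∈ R.children i ↔ c ≠ R.root ∧ R.parent c = i := by simp [children]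

lemma belowSum_eq [Fintype V] (g : V → ℕ) (i : V) :
    R.belowSum g i = g i + ∑ c ∈ R.children i, R.belowSum g c := by
  classical
  unfold belowSum
  have hdisj : ∀ c ∈ R.children i, ∀ c' ∈ R.children i, c ≠ c' →
      Disjoint (Finset.univ.filter (· ∈ R.below c)) (Finset.univ.filter (· ∈ R.below c')) := by
    intro c hc c' hc' hne
    rw [mem_children] at hc hc'
    rw [Finset.disjoint_left]
    intro v h1 h2
    refine hne (R.eq_of_mem_below (by simpa using h1) (by simpa using h2) hc.1 ?_)
    rw [← R.depth_parent c hc.1, ← R.depth_parent c' hc'.1, hc.2, hc'.2]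
  have hset : (Finset.univ.filter (· ∈ R.below i))
      = insert i ((R.children i).biUnion fun c => Finset.univ.filter (· ∈ R.below c)) := by
    ext v
    simp only [Finset.mem_filter, Finset.mem_univ, true_and, Finset.mem_insert,
      Finset.mem_biUnion, mem_children]
    constructor
    · intro h
      by_cases hv : v = i
      · exact Or.inl hv
      · obtain ⟨c, h1, h2, h3⟩ := R.exists_child_of_mem_below h hv
        exact Or.inr ⟨c, ⟨h1, h2⟩, h3⟩
    · rintro (rfl | ⟨c, ⟨h1, rfl⟩, h3⟩)
      · exact R.mem_below_self _
      · exact R.below_subset (R.mem_below_of_parent (R.mem_below_self _)) h3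
  have hi : i ∉ (R.children i).biUnion fun c => Finset.univ.filter (· ∈ R.below c) := by
    simp only [Finset.mem_filter, Finset.mem_univ, true_and, Finset.mem_biUnion, mem_children,
      not_exists, not_and]
    rintro c ⟨h1, rfl⟩ h3
    have h4 := R.depth_le_of_mem_below h3
    have h5 := R.depth_parent c h1
    omega
  rw [hset, Finset.sum_insert hi, Finset.sum_biUnion hdisj]

lemma belowSum_root [Fintype V] (g : V → ℕ) : R.belowSum g R.root = ∑ v, g v := by
  simp [belowSum, R.mem_below_root]

lemma belowSum_le [Fintype V] (g : V → ℕ) (hg : ∀ v, g v ≤ 1) (i : V) :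
    R.belowSum g i ≤ (R.below i).ncard := by
  classical
  rw [Set.ncard_eq_toFinset_card']
  calc R.belowSum g i ≤ ∑ v with v ∈ R.below i, 1 := Finset.sum_le_sum fun v _ => hg v
    _ = _ := by
      rw [Finset.sum_const, smul_eq_mul, mul_one]
      congr 1
      ext; simp

end Rooting

/-! ### Rooting by distance, and the centroid -/

lemma exists_adj_dist_of_ne {V : Type*} {T : SimpleGraph V} (hT : T.Connected) {r v : V}
    (h : v ≠ r) : ∃ w, T.Adj v w ∧ T.dist r w + 1 = T.dist r v := by
  obtain ⟨p, hp⟩ := hT.exists_walk_length_eq_dist v r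
  cases p with
  | nil => exact absurd rfl h
  | @cons _ w _ hvw q =>
    refine ⟨w, hvw, ?_⟩
    have h1 := SimpleGraph.dist_le q
    have h2 := hT.dist_triangle (u := v) (v := w) (w := r)
    rw [SimpleGraph.dist_eq_one_iff_adj.2 hvw] at h2
    rw [SimpleGraph.Walk.length_cons] at hp
    rw [SimpleGraph.dist_comm (u := r), SimpleGraph.dist_comm (u := r)]
    omega

/-- The rooting of a tree at a given node, by distances from that node. -/
lemma exists_rooting {V : Type*} {T : SimpleGraph V} (hT : T.IsTree) (r : V) :
    ∃ R : Rooting T, R.root = r ∧ ∀ v, R.depth v = T.dist r v := by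
  classical
  have hex : ∀ v, ∃ w, v ≠ r → T.Adj v w ∧ T.dist r w + 1 = T.dist r v := by
    intro v
    by_cases h : v = r
    · exact ⟨v, fun h' => absurd h h'⟩
    · obtain ⟨w, hw⟩ := exists_adj_dist_of_ne hT.connected h
      exact ⟨w, fun _ => hw⟩
  choose p hp using hex
  have huniq : ∀ u v, T.Adj u v → T.dist r v + 1 = T.dist r u → u ≠ r ∧ p u = v := by
    intro u v huv hd
    have hur : u ≠ r := by
      rintro rfl
      simp at hd
    refine ⟨hur, ?_⟩
    obtain ⟨h1, h2⟩ := hp u hur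
    obtain ⟨q, hq, hql⟩ := hT.connected.exists_path_of_dist v r
    obtain ⟨q', hq', hql'⟩ := hT.connected.exists_path_of_dist (p u) r
    -- Geodesics from `u` through `v` and through `p u` are both paths to `r`; acyclicity makes them
    -- equal, hence also their second vertices.
    have e1 : (SimpleGraph.Walk.cons huv q).IsPath := by
      apply SimpleGraph.Walk.isPath_of_length_eq_dist
      rw [SimpleGraph.Walk.length_cons, hql, SimpleGraph.dist_comm, hd, SimpleGraph.dist_comm]
    have e2 : (SimpleGraph.Walk.cons h1 q').IsPath := by
      apply SimpleGraph.Walk.isPath_of_length_eq_dist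
      rw [SimpleGraph.Walk.length_cons, hql', SimpleGraph.dist_comm, h2, SimpleGraph.dist_comm]
    have := (hT.isAcyclic.subsingleton_path u r).elim ⟨_, e1⟩ ⟨_, e2⟩
    have := congrArg (fun w => w.1.snd) this
    simpa using this.symm
  refine ⟨⟨r, fun v => if v = r then r else p v, T.dist r, by simp, by simp, ?_, ?_⟩, rfl,
    fun _ => rfl⟩
  · intro v hv
    simp only [hv, if_false]
    exact (hp v hv).2
  · intro u v
    constructor
    · intro h
      rcases hT.dist_eq_dist_add_one_of_adj r h with h1 | h1
      · obtain ⟨h2, h3⟩ := huniq u v h h1.symm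
        exact Or.inl ⟨h2, by simp [h2, h3]⟩
      · obtain ⟨h2, h3⟩ := huniq v u h.symm h1.symm
        exact Or.inr ⟨h2, by simp [h2, h3]⟩
    · rintro (⟨h, rfl⟩ | ⟨h, rfl⟩)
      · simpa [h] using (hp u h).1
      · simpa [h] using (hp v h).1.symm

/-- A tree can be rooted at a centroid: no proper subtree holds more than half of the nodes. -/
lemma exists_centroid_rooting {V : Type*} [Fintype V] {T : SimpleGraph V} (hT : T.IsTree) :
    ∃ R : Rooting T, ∀ c, c ≠ R.root → 2 * (R.below c).ncard ≤ Fintype.card V := by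
  classical
  have := hT.connected.nonempty
  obtain ⟨r, -, hr⟩ := Finset.exists_min_image (Finset.univ : Finset V)
    (fun r => ∑ v, T.dist r v) Finset.univ_nonempty
  obtain ⟨R, hR, hd⟩ := exists_rooting hT r
  refine ⟨R, ?_⟩
  have hchild : ∀ c, c ≠ R.root → R.parent c = R.root →
      2 * (R.below c).ncard ≤ Fintype.card V := by
    intro c hc hpc
    have hmin := hr c (Finset.mem_univ _)
    -- Moving from `r` to `c` brings the nodes below `c` one step closer and the others at most one
    -- step farther. Summed, this meets the minimality of the total distance at `r`.
    have h1 : ∀ v, T.dist c v + (if v ∈ R.below c then 2 else 0) ≤ T.dist r v + 1 := by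
      intro v
      split_ifs with hv
      · obtain ⟨n, hn⟩ := hv
        have hle : ∀ n v, T.dist v (R.parent^[n] v) ≤ n := by
          intro n v
          induction n with
          | zero => simp
          | succ n ih =>
            rw [Function.iterate_succ_apply']
            by_cases h : R.parent^[n] v = R.root
            · rw [h, R.parent_root, ← h]
              omega
            · have h2 := hT.connected.dist_triangle (u := v) (v := R.parent^[n] v)
                (w := R.parent (R.parent^[n] v))
              rw [SimpleGraph.dist_eq_one_iff_adj.2 (R.adj_parent h)] at h2
              omega
        have h2 := hle n v
        have h3 := R.depth_iterate n v
        have h4 := R.depth_parent c hc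
        rw [hpc, R.depth_root] at h4
        rw [hn, SimpleGraph.dist_comm] at h2
        rw [hn, hd v] at h3
        omega
      · have h2 := hT.connected.dist_triangle (u := c) (v := r) (w := v)
        have h3 := R.adj_parent hc
        rw [hpc, hR] at h3
        rw [SimpleGraph.dist_eq_one_iff_adj.2 h3] at h2
        omega
    have h2 := Finset.sum_le_sum fun v (_ : v ∈ Finset.univ) => h1 v
    rw [Finset.sum_add_distrib, Finset.sum_add_distrib, ← Finset.sum_filter] at h2
    simp only [Finset.sum_const, smul_eq_mul, Finset.card_univ] at h2
    have h3 : (R.below c).ncard = (Finset.univ.filter (· ∈ R.below c)).card := by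
      rw [Set.ncard_eq_toFinset_card']
      congr 1
      ext; simp
    rw [h3]
    omega
  intro c hc
  obtain ⟨c', h1, h2, h3⟩ := R.exists_child_of_mem_below (R.mem_below_root c) hc
  have := hchild c' h1 h2
  have := Set.ncard_le_ncard (R.below_subset h3) (Set.toFinite _)
  omega

/-! ### Prefix codes -/

/-- The converse of Kraft's inequality: there is a prefix code with prescribed lengths, here given
by their differences `r` from `L`. -/
lemma exists_prefix_code {α : Type*} (s : Finset α) (L : ℕ) (r : α → ℕ)
    (h : ∑ u ∈ s, 2 ^ r u ≤ 2 ^ L) :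
    ∃ c : α → List Bool, (∀ u ∈ s, (c u).length + r u = L) ∧
      ∀ u ∈ s, ∀ v ∈ s, c u <+: c v → u = v := by
  classical
  -- Longest codewords are added last, so a new word need only avoid extending an old one.
  induction s using Finset.induction_on_max_value (fun u => L - r u) with
  | empty => exact ⟨fun _ => [], by simp, by simp⟩
  | insert a s ha hmax ih =>
    rw [Finset.sum_insert ha] at h
    obtain ⟨c, hc, hpre⟩ := ih ((Nat.le_add_left _ _).trans h)
    have hra : r a ≤ L := by
      by_contra hlt
      have : 2 ^ L < 2 ^ r a := Nat.pow_lt_pow_right (by norm_num) (by omega)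
      omega
    obtain ⟨l, hl⟩ := Nat.exists_eq_add_of_le' hra
    obtain ⟨w, hw⟩ : ∃ w : List.Vector Bool l, ∀ u ∈ s, ¬ c u <+: w.1 := by
      by_contra! hcon
      have hcov : (Finset.univ : Finset (List.Vector Bool l))
          ⊆ s.biUnion fun u => Finset.univ.filter fun w => c u <+: w.1 := by
        intro w _
        obtain ⟨u, hu, hw⟩ := hcon w
        simp only [Finset.mem_biUnion, Finset.mem_filter, Finset.mem_univ, true_and]
        exact ⟨u, hu, hw⟩
      -- The extensions of `c u` to length `l`, scaled by `2 ^ r a`, count at most `2 ^ r u`. If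
      -- they covered all words of length `l`, the sum over `s` would reach `2 ^ L`, leaving no room
      -- for `a`.
      have hcard : ∀ u ∈ s,
          (Finset.univ.filter fun w : List.Vector Bool l => c u <+: w.1).card * 2 ^ r a
            ≤ 2 ^ r u := by
        intro u hu
        have h1 : (Finset.univ.filter fun w : List.Vector Bool l => c u <+: w.1).card
            ≤ (Finset.univ : Finset (List.Vector Bool (l - (c u).length))).card := by
          refine Finset.card_le_card_of_injOn
            (fun w => ⟨w.1.drop (c u).length, by simp⟩) (fun _ _ => Finset.mem_coe.2 (Finset.mem_univ _)) ?_
          intro w hw w' hw' heq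
          simp only [Finset.coe_filter, Finset.mem_univ, true_and, Set.mem_ofPred_eq] at hw hw'
          obtain ⟨x, hx⟩ := hw
          obtain ⟨x', hx'⟩ := hw'
          have h2 : w.1.drop (c u).length = w'.1.drop (c u).length := congrArg Subtype.val heq
          rw [← hx, ← hx', List.drop_left, List.drop_left] at h2
          apply Subtype.ext
          rw [← hx, ← hx', h2]
        rw [Finset.card_univ, card_vector, Fintype.card_bool] at h1
        have h3 := hmax u hu
        have h4 := hc u hu
        calc _ ≤ 2 ^ (l - (c u).length) * 2 ^ r a := Nat.mul_le_mul_right _ h1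
          _ = 2 ^ r u := by
            rw [← pow_add]
            congr 1
            omega
      have h1 := (Finset.card_le_card hcov).trans Finset.card_biUnion_le
      rw [Finset.card_univ, card_vector, Fintype.card_bool] at h1
      have h2 := Nat.mul_le_mul_right (2 ^ r a) h1
      rw [Finset.sum_mul, ← pow_add, ← hl] at h2
      have h3 := h2.trans (Finset.sum_le_sum hcard)
      have : 0 < 2 ^ r a := by positivity
      omega
    refine ⟨Function.update c a w.1, ?_, ?_⟩
    · intro u hu
      rcases Finset.mem_insert.1 hu with rfl | hus
      · rw [Function.update_self, w.2]
        exact hl.symm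
      · rw [Function.update_of_ne (by rintro rfl; exact ha hus)]
        exact hc u hus
    · intro u hu v hv huv
      rcases Finset.mem_insert.1 hu with rfl | hus <;> rcases Finset.mem_insert.1 hv with rfl | hvs
      · rfl
      · rw [Function.update_self, Function.update_of_ne (by rintro rfl; exact ha hvs)] at huv
        exfalso
        have h1 := hc v hvs
        have h2 := hmax v hvs
        have h3 : (c v).length ≤ w.1.length := by rw [w.2]; omega
        exact hw v hvs (huv.eq_of_length_le h3 ▸ List.prefix_rfl)
      · rw [Function.update_self, Function.update_of_ne (by rintro rfl; exact ha hus)] at huv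
        exact absurd huv (hw u hus)
      · rw [Function.update_of_ne (by rintro rfl; exact ha hus),
          Function.update_of_ne (by rintro rfl; exact ha hvs)] at huv
        exact hpre u hus v hvs huv

/-! ### The convergecast strategy -/

/-- The data of the convergecast strategy: a rooting, a prefix code for the partial sums
that each node sends to its parent, and bounds on the code lengths and the depth. -/
structure Scheme {V : Type*} (T : SimpleGraph V) (B : ℕ) where
  R : Rooting T
  a : ℕ
  b : ℕ
  M : ℕ
  N : ℕ
  U : V → Finset (Fin B → ℕ)
  code : V → (Fin B → ℕ) → List Bool
  le_M : B ≤ M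
  depth_le : ∀ v, R.depth v ≤ N
  length_le : ∀ v, ∀ u ∈ U v, (code v u).length ≤ M
  prefix_free : ∀ v, ∀ u ∈ U v, ∀ u' ∈ U v, code v u <+: code v u' → u = u'
  mem_U : ∀ v, v ≠ R.root → ∀ u : Fin B → ℕ, (∀ k, u k ≤ min (R.below v).ncard (b + 1)) → u ∈ U v

namespace Scheme

variable {V : Type*} {T : SimpleGraph V} {B : ℕ} (P : Scheme T B)

/-- The round in which node `v` starts to send to its parent. -/
def upTime (v : V) : ℕ := (P.N - P.R.depth v) * P.M

/-- The round in which the parent of `v` starts to send to `v`. -/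
def downTime (v : V) : ℕ := (P.N + P.R.depth v) * P.M

/-- In slots of `M` rounds, depth d sends up in slot N - d and is answered in slot N + d; so every
child is heard before its parent speaks. -/
lemma upTime_child {c : V} (hc : c ≠ P.R.root) :
    P.upTime c + P.M ≤ P.upTime (P.R.parent c) := by
  have h1 := P.R.depth_parent c hc
  have h2 := P.depth_le c
  unfold upTime
  rw [show P.N - P.R.depth (P.R.parent c) = (P.N - P.R.depth c) + 1 by omega, add_mul, one_mul]

lemma upTime_add_le {c : V} (hc : c ≠ P.R.root) : P.upTime c + P.M ≤ P.N * P.M := by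
  have h1 := P.R.depth_parent c hc
  have h2 := P.depth_le c
  unfold upTime
  calc _ = (P.N - P.R.depth c + 1) * P.M := by ring
    _ ≤ _ := Nat.mul_le_mul_right _ (by omega)

lemma le_downTime (v : V) : P.N * P.M ≤ P.downTime v := Nat.mul_le_mul_right _ (by omega)

lemma downTime_parent {v : V} (hv : v ≠ P.R.root) :
    P.downTime (P.R.parent v) + P.M = P.downTime v := by
  have h1 := P.R.depth_parent v hv
  unfold downTime
  rw [← h1]
  ring

lemma downTime_add_le (v : V) : P.downTime v + P.M ≤ (2 * P.N + 1) * P.M := by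
  have h2 := P.depth_le v
  unfold downTime
  calc _ = (P.N + P.R.depth v + 1) * P.M := by ring
    _ ≤ _ := Nat.mul_le_mul_right _ (by omega)

/-- Every link joins a node to its parent. -/
lemma exists_lower (e : T.edgeSet) :
    ∃ v, v ≠ P.R.root ∧ (e : Sym2 V) = s(v, P.R.parent v) := by
  obtain ⟨e, he⟩ := e
  induction e with
  | _ u v =>
    rcases (P.R.adj_iff u v).1 he with ⟨h, rfl⟩ | ⟨h, rfl⟩
    · exact ⟨u, h, rfl⟩
    · exact ⟨v, h, Sym2.eq_swap⟩

/-- The endpoint of a link that is farther from the root. -/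
noncomputable def lower (e : T.edgeSet) : V := (P.exists_lower e).choose

lemma lower_ne (e : T.edgeSet) : P.lower e ≠ P.R.root := (P.exists_lower e).choose_spec.1

lemma coe_eq_lower (e : T.edgeSet) : (e : Sym2 V) = s(P.lower e, P.R.parent (P.lower e)) :=
  (P.exists_lower e).choose_spec.2

lemma lower_eq {e : T.edgeSet} {v : V} (hv : v ≠ P.R.root) (h : (e : Sym2 V) = s(v, P.R.parent v)) :
    P.lower e = v :=
  P.R.edge_injective (P.lower_ne e) hv ((P.coe_eq_lower e).symm.trans h)

lemma lower_mem (e : T.edgeSet) : P.lower e ∈ (e : Sym2 V) := by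
  rw [P.coe_eq_lower e]
  exact Sym2.mem_mk_left _ _

lemma parent_lower_mem (e : T.edgeSet) : P.R.parent (P.lower e) ∈ (e : Sym2 V) := by
  rw [P.coe_eq_lower e]
  exact Sym2.mem_mk_right _ _

/-- What a history of the link above `v` says about the partial sums in the subtree of `v`. -/
noncomputable def decode (v : V) (h : LinkHistory) : Fin B → ℕ :=
  open Classical in
  -- Past the end of the codeword `[s]?` is `none`, which is exactly silence on the link.
  if ex : ∃ u ∈ P.U v, ∀ s < P.M, h.getD (P.upTime v + s) none = (P.code v u)[s]?
  then ex.choose else 0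

/-- A history of the link above `v` whose codeword is still incomplete. -/
def Incomplete (v : V) (h : LinkHistory) : Prop :=
  ∃ u ∈ P.U v, h.length - P.upTime v < (P.code v u).length ∧
    ∀ s < h.length - P.upTime v, h.getD (P.upTime v + s) none = (P.code v u)[s]?

/-- The history of the link above `v`, as heard by `i`. -/
noncomputable def heard {i : V} (H : T.incidenceSet i → LinkHistory) (v : V) : LinkHistory :=
  open Classical in
  if h : s(v, P.R.parent v) ∈ T.incidenceSet i then H ⟨_, h⟩ else []

/-- The capped partial sums of the subtree of `i`, from what `i` knows. -/
noncomputable def gather [Fintype V] (i : V) (x : Fin B → Bool)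
    (H : T.incidenceSet i → LinkHistory) : Fin B → ℕ :=
  fun k => min (P.b + 1) ((x k).toNat + ∑ c ∈ P.R.children i, P.decode c (P.heard H c) k)

/-- The values of the function, from what `i` knows. -/
noncomputable def conclude [Fintype V] (i : V) (x : Fin B → Bool)
    (H : T.incidenceSet i → LinkHistory) : Fin B → Bool :=
  open Classical in
  fun k => if i = P.R.root then decide (P.a ≤ P.gather i x H k ∧ P.gather i x H k ≤ P.b)
    -- Silence here means that the subtree alone has more than `b` ones, so the default `false` is
    -- the correct value.
    else ((P.heard H i).getD (P.downTime i + k) none).getD false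

/-- Convergecast of the partial sums, followed by a broadcast of the result to those who do not know
it yet. -/
noncomputable def strategy [Fintype V] : Strategy T B :=
  open Classical in
  { rounds := (2 * P.N + 1) * P.M
    speaker := fun e h =>
      if P.upTime (P.lower e) ≤ h.length ∧ h.length < P.upTime (P.lower e) + P.M then
        if P.Incomplete (P.lower e) h then some ⟨P.lower e, P.lower_mem e⟩ else none
      else if hk : P.downTime (P.lower e) ≤ h.length ∧ h.length - P.downTime (P.lower e) < B then
        -- Decoding uses only the link's history, so both endpoints know which instances will be
        -- answered.
        if P.decode (P.lower e) h ⟨h.length - P.downTime (P.lower e), hk.2⟩ ≤ P.b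
        then some ⟨P.R.parent (P.lower e), P.parent_lower_mem e⟩ else none
      else none
    bit := fun i x H e =>
      if i = P.lower ⟨e.1, e.2.1⟩ then
        (P.code i (P.gather i x H)).getD ((H e).length - P.upTime i) false
      else if hk : (H e).length - P.downTime (P.lower ⟨e.1, e.2.1⟩) < B then
        P.conclude i x H ⟨_, hk⟩
      else false
    output := P.conclude }

/-- The capped partial sums of the subtree of `v`. -/
noncomputable def count [Fintype V] (X : V → Fin B → Bool) (v : V) : Fin B → ℕ :=
  fun k => min (P.b + 1) (P.R.belowSum (fun w => (X w k).toNat) v)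

/-- What happens in round `s` on the link above `v`. -/
noncomputable def entry [Fintype V] (X : V → Fin B → Bool) (v : V) (s : ℕ) : Option Bool :=
  if P.upTime v ≤ s ∧ s < P.upTime v + P.M then (P.code v (P.count X v))[s - P.upTime v]?
  else if hk : P.downTime v ≤ s ∧ s - P.downTime v < B then
    if P.count X v ⟨s - P.downTime v, hk.2⟩ ≤ P.b
    then some (sumInterval P.a P.b fun w => X w ⟨s - P.downTime v, hk.2⟩) else none
  else none

/-- The history of the link above `v` after `t` rounds. -/
noncomputable def hist [Fintype V] (X : V → Fin B → Bool) (t : ℕ) (v : V) : LinkHistory :=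
  (List.range t).map (P.entry X v)

/-! ### Correctness and cost of the strategy -/

variable [Fintype V]

@[simp] lemma length_hist (X : V → Fin B → Bool) (t : ℕ) (v : V) : (P.hist X t v).length = t := by
  simp [hist]

lemma getD_hist (X : V → Fin B → Bool) (t : ℕ) (v : V) {s : ℕ} (hs : s < t) :
    (P.hist X t v).getD s none = P.entry X v s := by
  simp [hist, List.getD_eq_getElem?_getD, hs]

lemma count_mem (X : V → Fin B → Bool) {v : V} (hv : v ≠ P.R.root) : P.count X v ∈ P.U v := by
  refine P.mem_U v hv _ fun k => ?_
  have := P.R.belowSum_le (fun w => (X w k).toNat) (fun w => Bool.toNat_le _) v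
  unfold count
  omega

lemma entry_up (X : V → Fin B → Bool) (v : V) {s : ℕ} (hs : s < P.M) :
    P.entry X v (P.upTime v + s) = (P.code v (P.count X v))[s]? := by
  simp [entry, hs]

lemma decode_hist (X : V → Fin B → Bool) {v : V} (hv : v ≠ P.R.root) {t : ℕ}
    (ht : P.upTime v + P.M ≤ t) : P.decode v (P.hist X t v) = P.count X v := by
  have hmem := P.count_mem X hv
  have h0 : ∀ s < P.M, (P.hist X t v).getD (P.upTime v + s) none
      = (P.code v (P.count X v))[s]? := by
    intro s hs
    rw [P.getD_hist X t v (by omega), P.entry_up X v hs]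
  have ex : ∃ u ∈ P.U v, ∀ s < P.M,
      (P.hist X t v).getD (P.upTime v + s) none = (P.code v u)[s]? := ⟨_, hmem, h0⟩
  unfold decode
  rw [dif_pos ex]
  obtain ⟨h1, h2⟩ := ex.choose_spec
  refine P.prefix_free v _ h1 _ hmem ?_
  have : P.code v ex.choose = P.code v (P.count X v) := by
    refine List.ext_getElem? fun s => ?_
    rcases lt_or_ge s P.M with hs | hs
    · rw [← h2 s hs, h0 s hs]
    · rw [List.getElem?_eq_none ((P.length_le v _ h1).trans hs),
        List.getElem?_eq_none ((P.length_le v _ hmem).trans hs)]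
  rw [this]

/-- The end of a codeword must be visible from the link alone. Prefix-freeness provides this: a
finished word still compatible with a longer codeword would be a proper prefix of it. -/
lemma incomplete_hist_iff (X : V → Fin B → Bool) {v : V} (hv : v ≠ P.R.root) {s : ℕ}
    (hs : s < P.M) : P.Incomplete v (P.hist X (P.upTime v + s) v) ↔
      s < (P.code v (P.count X v)).length := by
  have hmem := P.count_mem X hv
  unfold Incomplete
  simp only [length_hist, Nat.add_sub_cancel_left]
  have h0 : ∀ s' < s, (P.hist X (P.upTime v + s) v).getD (P.upTime v + s') none
      = (P.code v (P.count X v))[s']? := by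
    intro s' hs'
    rw [P.getD_hist X _ v (by omega), P.entry_up X v (by omega)]
  constructor
  · rintro ⟨u, hu, hlt, hag⟩
    by_contra hle
    push Not at hle
    have hpre : P.code v (P.count X v) <+: P.code v u := by
      rw [List.prefix_iff_getElem?]
      intro k hk
      rw [← hag k (by omega), h0 k (by omega), List.getElem?_eq_getElem hk]
    have := P.prefix_free v _ hmem _ hu hpre
    rw [this] at hle
    omega
  · intro h
    exact ⟨_, hmem, h, h0⟩

/-- The histories of all links after `t` rounds. -/
noncomputable def hists (X : V → Fin B → Bool) (t : ℕ) (e : T.edgeSet) : LinkHistory :=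
  P.hist X t (P.lower e)

lemma heard_hists (X : V → Fin B → Bool) (t : ℕ) {i v : V} (hv : v ≠ P.R.root)
    (h : i = v ∨ i = P.R.parent v) :
    P.heard (Strategy.localView (P.hists X t) i) v = P.hist X t v := by
  have hmem : s(v, P.R.parent v) ∈ T.incidenceSet i := by
    refine ⟨P.R.adj_parent hv, ?_⟩
    rw [Sym2.mem_iff]
    exact h
  unfold heard
  rw [dif_pos hmem]
  simp only [Strategy.localView, hists]
  rw [P.lower_eq hv rfl]

lemma gather_hists (X : V → Fin B → Bool) (t : ℕ) (i : V)
    (ht : ∀ c ∈ P.R.children i, P.upTime c + P.M ≤ t) :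
    P.gather i (X i) (Strategy.localView (P.hists X t) i) = P.count X i := by
  funext k
  unfold gather
  have h1 : ∀ c ∈ P.R.children i,
      P.decode c (P.heard (Strategy.localView (P.hists X t) i) c) k = P.count X c k := by
    intro c hc
    have hc' := P.R.mem_children.1 hc
    rw [P.heard_hists X t hc'.1 (Or.inr hc'.2.symm), P.decode_hist X hc'.1 (ht c hc)]
  rw [Finset.sum_congr rfl h1]
  unfold count
  rw [P.R.belowSum_eq _ i]
  -- Capping summands does not change a capped sum, so the children's capped counts suffice.
  have cap : ∀ (s : Finset V) (g : V → ℕ) (x : ℕ),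
      min (P.b + 1) (x + ∑ c ∈ s, min (P.b + 1) (g c)) = min (P.b + 1) (x + ∑ c ∈ s, g c) := by
    classical
    intro s g x
    induction s using Finset.induction_on generalizing x with
    | empty => simp
    | insert c s hc ih =>
      rw [Finset.sum_insert hc, Finset.sum_insert hc, ← add_assoc, ← add_assoc, ih]
      omega
  exact cap _ _ _

lemma sumInterval_eq_root (X : V → Fin B → Bool) (k : Fin B) :
    decide (P.a ≤ P.count X P.R.root k ∧ P.count X P.R.root k ≤ P.b)
      = sumInterval P.a P.b fun w => X w k := by
  unfold count sumInterval
  rw [P.R.belowSum_root, decide_eq_decide]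
  beta_reduce
  omega

lemma sumInterval_eq_false (X : V → Fin B → Bool) (v : V) (k : Fin B)
    (h : ¬ P.count X v k ≤ P.b) : sumInterval P.a P.b (fun w => X w k) = false := by
  classical
  have h1 : P.R.belowSum (fun w => (X w k).toNat) v ≤ ∑ w, (X w k).toNat :=
    Finset.sum_le_sum_of_subset (Finset.filter_subset _ _)
  unfold count at h
  unfold sumInterval
  rw [decide_eq_false_iff_not]
  beta_reduce
  omega

lemma entry_down (X : V → Fin B → Bool) {v : V} (hv : v ≠ P.R.root) (k : Fin B) :
    P.entry X v (P.downTime v + k) = if P.count X v k ≤ P.b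
      then some (sumInterval P.a P.b fun w => X w k) else none := by
  have h1 := P.upTime_add_le hv
  have h2 := P.le_downTime v
  unfold entry
  rw [if_neg (by omega)]
  simp

lemma conclude_hists (X : V → Fin B → Bool) (t : ℕ) (i : V) (h0 : P.N * P.M ≤ t)
    (h1 : i ≠ P.R.root → P.downTime i + P.M ≤ t) :
    P.conclude i (X i) (Strategy.localView (P.hists X t) i)
      = fun k => sumInterval P.a P.b fun w => X w k := by
  funext k
  unfold conclude
  by_cases hi : i = P.R.root
  · rw [if_pos hi, P.gather_hists X t i, hi, P.sumInterval_eq_root]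
    intro c hc
    exact (P.upTime_add_le (P.R.mem_children.1 hc).1).trans h0
  · have h2 := P.le_M
    have h3 := h1 hi
    have h4 := k.2
    rw [if_neg hi, P.heard_hists X t hi (Or.inl rfl), P.getD_hist X t i (by omega),
      P.entry_down X hi]
    split_ifs with h
    · rfl
    · exact (P.sumInterval_eq_false X i k h).symm

/-- The induction step behind `run_strategy`: whatever the sender needs was sent in earlier slots,
so on the intended histories it sends the intended entry. -/
lemma transmission_hists (X : V → Fin B → Bool) (t : ℕ) (e : T.edgeSet) :
    P.strategy.transmission X (P.hists X t) e = P.entry X (P.lower e) t := by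
  have hv := P.lower_ne e
  have hlen : (P.hists X t e).length = t := P.length_hist X t _
  have hup := P.upTime_add_le hv
  have hdn := P.le_downTime (P.lower e)
  by_cases h1 : P.upTime (P.lower e) ≤ t ∧ t < P.upTime (P.lower e) + P.M
  · obtain ⟨s, rfl⟩ := Nat.exists_eq_add_of_le h1.1
    have hs : s < P.M := by omega
    have hinc := P.incomplete_hist_iff X hv hs
    rw [P.entry_up X _ hs]
    unfold Strategy.transmission
    simp only [strategy, hlen]
    rw [if_pos h1]
    by_cases hi : P.Incomplete (P.lower e) (P.hists X (P.upTime (P.lower e) + s) e)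
    · rw [if_pos hi, Option.map_some]
      have hlt := hinc.1 hi
      rw [if_pos rfl, P.gather_hists X _ _ fun c hc => ?_]
      · have : (Strategy.localView (P.hists X (P.upTime (P.lower e) + s)) (P.lower e)
            ⟨e.1, e.2, P.lower_mem e⟩).length = P.upTime (P.lower e) + s := hlen
        rw [this, Nat.add_sub_cancel_left, List.getD_eq_getElem _ _ hlt,
          List.getElem?_eq_getElem hlt]
      · have hc' := P.R.mem_children.1 hc
        have := P.upTime_child hc'.1
        rw [hc'.2] at this
        change _ ≤ P.upTime (P.lower e) at this
        omega
    · rw [if_neg hi, Option.map_none, List.getElem?_eq_none]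
      exact not_lt.1 fun h => hi (hinc.2 h)
  · by_cases h2 : P.downTime (P.lower e) ≤ t ∧ t - P.downTime (P.lower e) < B
    · obtain ⟨s, rfl⟩ := Nat.exists_eq_add_of_le h2.1
      have hs : s < B := by omega
      have hd : P.decode (P.lower e) (P.hists X (P.downTime (P.lower e) + s) e)
          = P.count X (P.lower e) := P.decode_hist X hv (by omega)
      rw [P.entry_down X hv ⟨s, hs⟩]
      unfold Strategy.transmission
      simp only [strategy, hlen, Nat.add_sub_cancel_left]
      rw [if_neg h1, dif_pos ⟨by omega, hs⟩, hd]
      split_ifs with h3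
      · rw [Option.map_some, if_neg (P.R.parent_ne hv)]
        have : (Strategy.localView (P.hists X (P.downTime (P.lower e) + s))
            (P.R.parent (P.lower e))
            ⟨e.1, e.2, P.parent_lower_mem e⟩).length = P.downTime (P.lower e) + s := hlen
        simp only [this, Nat.add_sub_cancel_left]
        rw [dif_pos hs, P.conclude_hists X _ _ (by omega)]
        intro _
        have := P.downTime_parent hv
        omega
      · rfl
    · unfold Strategy.transmission entry
      simp only [strategy, hlen]
      rw [if_neg h1, dif_neg h2, if_neg h1, dif_neg h2]
      rfl

lemma run_strategy (X : V → Fin B → Bool) (t : ℕ) : P.strategy.run X t = P.hists X t := by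
  induction t with
  | zero => rfl
  | succ t ih =>
    funext e
    simp only [Strategy.run]
    rw [ih, P.transmission_hists X t e]
    simp [hists, hist, List.range_succ]

lemma computes : P.strategy.Computes (sumInterval P.a P.b) := by
  intro X i
  rw [P.run_strategy]
  refine P.conclude_hists X _ i ?_ fun _ => P.downTime_add_le i
  exact Nat.mul_le_mul_right _ (by omega)

lemma bitsOn_le (X : V → Fin B → Bool) (e : T.edgeSet) :
    P.strategy.bitsOn X e ≤ (P.code (P.lower e) (P.count X (P.lower e))).length
      + (Finset.univ.filter fun k => P.count X (P.lower e) k ≤ P.b).card := by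
  unfold Strategy.bitsOn
  rw [P.run_strategy]
  simp only [hists, hist]
  generalize P.lower e = v
  rw [List.countP_map, List.countP_eq_length_filter,
    ← List.toFinset_card_of_nodup (List.nodup_range.filter _)]
  refine le_trans (Finset.card_le_card (t :=
    (Finset.range (P.code v (P.count X v)).length).image (P.upTime v + ·) ∪
    (Finset.univ.filter fun k => P.count X v k ≤ P.b).image
      fun k : Fin B => P.downTime v + k) ?_) ?_
  · intro s hs
    replace hs : (P.entry X v s).isSome := (List.mem_filter.1 (List.mem_toFinset.1 hs)).2
    rw [Finset.mem_union, Finset.mem_image, Finset.mem_image]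
    unfold entry at hs
    split_ifs at hs with h1 h2 h3
    · left
      refine ⟨s - P.upTime v, ?_, by omega⟩
      rw [Finset.mem_range]
      by_contra h
      rw [List.getElem?_eq_none (not_lt.1 h)] at hs
      simp at hs
    · right
      exact ⟨⟨s - P.downTime v, h2.2⟩, by simpa using h3, by simp; omega⟩
    · simp at hs
    · simp at hs
  · refine (Finset.card_union_le _ _).trans (Nat.add_le_add ?_ Finset.card_image_le)
    exact Finset.card_image_le.trans (by simp)

end Scheme

/-! ### Kraft sum and the upper bound -/

/-- The weight is a product over coordinates. One coordinate sums to 2(b + 1) + 1 if the cap b + 1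
is attainable, and to 2(m + 1) otherwise. -/
lemma sum_two_pow_card_filter (B b m : ℕ) :
    ∑ u ∈ Fintype.piFinset fun _ : Fin B => Finset.range (min m (b + 1) + 1),
      2 ^ (Finset.univ.filter fun k => u k ≤ b).card ≤ min (2 * b + 3) (2 * m + 2) ^ B := by
  have h1 : ∀ u : Fin B → ℕ, 2 ^ (Finset.univ.filter fun k => u k ≤ b).card
      = ∏ k, if u k ≤ b then 2 else 1 := by
    intro u
    rw [Finset.prod_ite]
    simp
  simp only [h1]
  rw [Finset.sum_prod_piFinset (Finset.range (min m (b + 1) + 1))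
    (fun _ q => if q ≤ b then 2 else 1), Finset.prod_const, Finset.card_univ, Fintype.card_fin]
  refine Nat.pow_le_pow_left ?_ B
  have h2 : ∑ q ∈ Finset.range (b + 1), (if q ≤ b then 2 else 1) = 2 * b + 2 := by
    rw [Finset.sum_congr rfl (g := fun _ => 2)
      fun q hq => if_pos (by have := Finset.mem_range.1 hq; omega)]
    simp
    ring
  rcases le_or_gt m b with h | h
  · rw [min_eq_left (by omega : m ≤ b + 1), min_eq_right (by omega)]
    calc _ ≤ ∑ q ∈ Finset.range (m + 1), 2 :=
          Finset.sum_le_sum fun q _ => by split_ifs <;> omega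
      _ = _ := by simp; ring
  · rw [min_eq_right (by omega : b + 1 ≤ m), min_eq_left (by omega), Finset.sum_range_succ, h2]
    simp

/-- The upper bound, with sizes of the subtrees of a rooted tree. -/
lemma exists_strategy {V : Type*} [Fintype V] [DecidableEq V] {T : SimpleGraph V} (R : Rooting T)
    (a b B : ℕ) :
    ∃ S : Strategy T B, S.Computes (sumInterval a b) ∧
      ∀ (c : V) (hc : c ≠ R.root), S.worstCaseBits ⟨s(c, R.parent c), R.adj_parent hc⟩
        ≤ Nat.clog 2 (min (2 * b + 3) (2 * (R.below c).ncard + 2) ^ B) := by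
  let U : V → Finset (Fin B → ℕ) := fun v =>
    Fintype.piFinset fun _ => Finset.range (min (R.below v).ncard (b + 1) + 1)
  let L : V → ℕ := fun v => Nat.clog 2 (min (2 * b + 3) (2 * (R.below v).ncard + 2) ^ B)
  -- The length deficit of `u` is the number of answers it will cost, so codeword and answers total
  -- `L v`.
  have hcode := fun v => exists_prefix_code (U v) (L v)
    (fun u => (Finset.univ.filter fun k => u k ≤ b).card)
    ((sum_two_pow_card_filter B b _).trans (Nat.le_pow_clog (by norm_num) _))
  choose code hlen hpre using hcode
  have hmem : ∀ v (u : Fin B → ℕ), (∀ k, u k ≤ min (R.below v).ncard (b + 1)) → u ∈ U v :=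
    fun v u hu => Fintype.mem_piFinset.2 fun k => Finset.mem_range.2 (Nat.lt_succ_of_le (hu k))
  let P : Scheme T B :=
    { R := R, a := a, b := b, U := U, code := code
      M := B + ∑ v, L v
      N := ∑ v, R.depth v
      le_M := Nat.le_add_right _ _
      depth_le := fun v => Finset.single_le_sum (f := R.depth) (fun _ _ => Nat.zero_le _)
        (Finset.mem_univ v)
      length_le := fun v u hu => by
        have h1 := hlen v u hu
        have h2 := Finset.single_le_sum (f := L) (fun _ _ => Nat.zero_le _) (Finset.mem_univ v)
        omega
      prefix_free := hpre
      mem_U := fun v _ u hu => hmem v u hu }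
  refine ⟨P.strategy, P.computes, fun c hc => Finset.sup_le fun X _ => ?_⟩
  refine (P.bitsOn_le X _).trans ?_
  rw [P.lower_eq hc rfl]
  exact (hlen c _ (P.count_mem X hc)).le

lemma clog_le_ceil_mul_logb (W B : ℕ) (hW : 0 < W) {w : ℝ} (hw : (W : ℝ) ≤ w) :
    Nat.clog 2 (W ^ B) ≤ ⌈(B : ℝ) * Real.logb 2 w⌉₊ := by
  refine Nat.clog_le_of_le_pow ?_
  have hWR : (0 : ℝ) < W := by exact_mod_cast hW
  have h : ((W : ℝ) ^ B) ≤ 2 ^ ⌈(B : ℝ) * Real.logb 2 w⌉₊ := by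
    calc (W : ℝ) ^ B ≤ w ^ B := by gcongr
      _ = (2 : ℝ) ^ (Real.logb 2 (w ^ B)) :=
        (Real.rpow_logb (by norm_num) (by norm_num) (pow_pos (hWR.trans_le hw) B)).symm
      _ ≤ (2 : ℝ) ^ ((⌈(B : ℝ) * Real.logb 2 w⌉₊ : ℕ) : ℝ) := by
        rw [Real.logb_pow]
        exact Real.rpow_le_rpow_of_exponent_le (by norm_num) (Nat.le_ceil _)
      _ = _ := Real.rpow_natCast _ _
  exact_mod_cast h

end TreeNetwork

theorem theorem4 {V : Type*} [Fintype V] [DecidableEq V] (T : SimpleGraph V) (hT : T.IsTree)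
    (a b : ℕ) (hab : a ≤ b) (hb : (b : ℝ) ≤ (Fintype.card V : ℝ) / 2) (B : ℕ) :
    (∀ S : TreeNetwork.Strategy T B, S.Computes (TreeNetwork.sumInterval a b) →
      ∀ (i j : V) (hij : T.Adj i j),
        (TreeNetwork.side T i j).ncard ≤ (TreeNetwork.side T i j)ᶜ.ncard →
        (B : ℝ) * Real.logb 2 (min (2 * (b : ℝ) - (a : ℝ) + 3)
            (((TreeNetwork.side T i j).ncard : ℝ) + 1))
          ≤ (S.worstCaseBits ⟨s(i, j), hij⟩ : ℝ)) ∧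
    (∃ S : TreeNetwork.Strategy T B, S.Computes (TreeNetwork.sumInterval a b) ∧
      ∀ (i j : V) (hij : T.Adj i j),
        (TreeNetwork.side T i j).ncard ≤ (TreeNetwork.side T i j)ᶜ.ncard →
        S.worstCaseBits ⟨s(i, j), hij⟩
          ≤ ⌈(B : ℝ) * Real.logb 2 (min (2 * ((b : ℝ) + 1) + 1)
              (2 * ((TreeNetwork.side T i j).ncard : ℝ) + 2))⌉₊) := by

  have hcard : ∀ A : Set V, A.ncard + Aᶜ.ncard = Fintype.card V := fun A => by
    rw [Set.ncard_add_ncard_compl, Nat.card_eq_fintype_card]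
  have hb2 : 2 * b ≤ Fintype.card V := by
    have : (b : ℝ) * 2 ≤ Fintype.card V := by linarith
    have : b * 2 ≤ Fintype.card V := by exact_mod_cast this
    omega
  constructor
  · intro S hS i j hij hle
    refine TreeNetwork.mul_logb_le_worstCaseBits hab S hS hij
      (TreeNetwork.not_mem_side_of_isTree hT hij) hle ?_
    -- The larger side has at least half of the nodes, hence at least `b`.
    have := hcard (TreeNetwork.side T i j)
    omega
  · obtain ⟨R, hR⟩ := TreeNetwork.exists_centroid_rooting hT
    obtain ⟨S, hS, hbits⟩ := TreeNetwork.exists_strategy R a b B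
    refine ⟨S, hS, fun i j hij hle => ?_⟩
    have main : ∀ c (hc : c ≠ R.root), (R.below c).ncard ≤ (TreeNetwork.side T i j).ncard →
        S.worstCaseBits ⟨s(c, R.parent c), R.adj_parent hc⟩
          ≤ ⌈(B : ℝ) * Real.logb 2 (min (2 * ((b : ℝ) + 1) + 1)
              (2 * ((TreeNetwork.side T i j).ncard : ℝ) + 2))⌉₊ := by
      intro c hc hle
      refine (hbits c hc).trans (TreeNetwork.clog_le_ceil_mul_logb _ _ (by positivity) ?_)
      have h1 : ((R.below c).ncard : ℝ) ≤ (TreeNetwork.side T i j).ncard := by exact_mod_cast hle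
      push_cast
      exact min_le_min (by linarith) (by linarith)
    rcases (R.adj_iff i j).1 hij with ⟨hi, rfl⟩ | ⟨hj, rfl⟩
    · exact main i hi (by rw [R.side_parent hi])
    · have h1 := Set.ncard_le_ncard (R.compl_below_subset_side hj) (Set.toFinite _)
      have h2 := hcard (R.below j)
      have h3 := hR j hj
      have h4 := main j hj (by omega)
      have h5 : (⟨s(R.parent j, j), hij⟩ : T.edgeSet) = ⟨s(j, R.parent j), R.adj_parent hj⟩ :=
        Subtype.ext Sym2.eq_swap
      rwa [h5]
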